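/- For complex numbers $a$ and $p$ write $(a;p)_n=\prod_{k=0}^{n-1}(1-ap^k)$ for integers $n\ge 0$ (so $(a;p)_0=1$) and, if $|p|<1$, $(a;p)_\infty=\prod_{k=0}^{\infty}(1-ap^k)$. Let $q\in\mathbb{C}$ with $|q|<1$. Then $$\sum_{n=0}^{\infty}\frac{q^{(3n^2+3n)/2}}{(q;q^2)_{n+1}\,(q;q)_n}=\frac{1}{(q;q^2)_\infty\,(q^4;q^{10})_\infty\,(q^6;q^{10})_\infty},$$ where the series and the three infinite products on the right converge unconditionally and no denominator vanishes. -/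

import Mathlib

/-- The finite q-shifted factorial `(a; q)_n = (1 - a)(1 - a q) ⋯ (1 - a q ^ (n - 1))`. -/
def qPoch (a q : ℂ) (n : ℕ) : ℂ :=
  ∏ k ∈ Finset.range n, (1 - a * q ^ k)

/-- The infinite q-shifted factorial `(a; q)_∞ = ∏_{k ≥ 0} (1 - a q ^ k)`. -/
noncomputable def qPochInf (a q : ℂ) : ℂ :=
  ∏' k : ℕ, (1 - a * q ^ k)

/-! The proof is Bailey's method. `baileySum_eq` expands q^{(n²+n)/2}/((q;q²)_{n+1}(q;q)_n) as the
bilateral sum Σ_r (-1)^r q^{r²+r}/((q;q)_{n-2r}(q;q)_{n+1+2r}). After multiplication by q^{n²+n},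
the sum over n is taken first: it is a Durfee rectangle sum, equal to q^{j²+j}/(q;q)_∞ with j = 2r
(`hasSum_bailey_kernel`). What remains is Σ_r (-1)^r q^{5r²+3r}/(q;q)_∞, and the Jacobi triple
product (`tsum_theta`) makes its numerator (q²;q¹⁰)_∞(q⁸;q¹⁰)_∞(q¹⁰;q¹⁰)_∞, which cancels against
factors of (q;q)_∞.

Both the triple product and the Bailey pair rest on q-Pascal recurrences for bilateral sums, in
which a shift of r absorbs the extra power of the base. -/

open Filter Topology

/-! ### Finite and infinite q-shifted factorials -/

section Basics

theorem one_sub_mul_pow_ne_zero {a q : ℂ} (ha : ‖a‖ < 1) (hq : ‖q‖ < 1) (k : ℕ) :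
    1 - a * q ^ k ≠ 0 := by
  intro h
  have h1 : ‖a * q ^ k‖ = 1 := by rw [← sub_eq_zero.mp h, norm_one]
  rw [norm_mul, norm_pow] at h1
  have h2 : ‖q‖ ^ k ≤ 1 := pow_le_one₀ (norm_nonneg _) hq.le
  have h3 : ‖a‖ * ‖q‖ ^ k ≤ ‖a‖ * 1 := by gcongr
  linarith

theorem qPoch_succ (a q : ℂ) (n : ℕ) : qPoch a q (n + 1) = qPoch a q n * (1 - a * q ^ n) :=
  Finset.prod_range_succ _ _

@[simp] theorem qPoch_zero (a q : ℂ) : qPoch a q 0 = 1 := Finset.prod_range_zero _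

theorem qPoch_ne_zero {a q : ℂ} (ha : ‖a‖ < 1) (hq : ‖q‖ < 1) (n : ℕ) : qPoch a q n ≠ 0 :=
  Finset.prod_ne_zero_iff.mpr fun k _ => one_sub_mul_pow_ne_zero ha hq k

theorem summable_norm_neg_mul_pow (a : ℂ) {q : ℂ} (hq : ‖q‖ < 1) :
    Summable fun k : ℕ => ‖-(a * q ^ k)‖ := by
  simpa [norm_mul, norm_pow] using
    (summable_geometric_of_lt_one (norm_nonneg q) hq).mul_left ‖a‖

theorem multipliable_one_sub_mul_pow (a : ℂ) {q : ℂ} (hq : ‖q‖ < 1) :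
    Multipliable fun k : ℕ => 1 - a * q ^ k := by
  simpa [sub_eq_add_neg] using multipliable_one_add_of_summable (summable_norm_neg_mul_pow a hq)

theorem qPochInf_ne_zero {a q : ℂ} (ha : ‖a‖ < 1) (hq : ‖q‖ < 1) : qPochInf a q ≠ 0 := by
  have := tprod_one_add_ne_zero_of_summable (f := fun k : ℕ => -(a * q ^ k))
    (fun k => by simpa [sub_eq_add_neg] using one_sub_mul_pow_ne_zero ha hq k)
    (summable_norm_neg_mul_pow a hq)
  simpa [qPochInf, sub_eq_add_neg] using this

theorem tendsto_qPoch (a : ℂ) {q : ℂ} (hq : ‖q‖ < 1) :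
    Tendsto (qPoch a q) atTop (𝓝 (qPochInf a q)) :=
  (multipliable_one_sub_mul_pow a hq).tendsto_prod_tprod_nat

theorem qPoch_mul (a q : ℂ) (m n : ℕ) :
    qPoch a q (m * n) = ∏ i ∈ Finset.range m, qPoch (a * q ^ i) (q ^ m) n := by
  induction n with
  | zero => simp
  | succ n ih =>
    rw [Nat.mul_succ, qPoch, Finset.prod_range_add, ← qPoch, ih]
    simp_rw [qPoch_succ, Finset.prod_mul_distrib]
    congr 1
    refine Finset.prod_congr rfl fun i _ => ?_
    ring

/-- Dissection of an infinite product along residue classes modulo `m`. -/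
theorem qPochInf_eq_prod (a : ℂ) {q : ℂ} (hq : ‖q‖ < 1) {m : ℕ} (hm : m ≠ 0) :
    qPochInf a q = ∏ i ∈ Finset.range m, qPochInf (a * q ^ i) (q ^ m) := by
  have hqm : ‖q ^ m‖ < 1 := by rw [norm_pow]; exact pow_lt_one₀ (norm_nonneg _) hq hm
  have h1 : Tendsto (fun n => qPoch a q (m * n)) atTop (𝓝 (qPochInf a q)) :=
    (tendsto_qPoch a hq).comp (tendsto_id.const_mul_atTop' (Nat.pos_of_ne_zero hm))
  refine tendsto_nhds_unique h1 ?_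
  simp_rw [qPoch_mul]
  exact tendsto_finsetProd _ fun i _ => tendsto_qPoch _ hqm

end Basics

/-! ### Reciprocal q-factorials at integer arguments -/

section Reciprocal

/-- `1 / (q; q)_k`, extended by zero to negative `k`. -/
noncomputable def qRecip (q : ℂ) (k : ℤ) : ℂ := if k < 0 then 0 else 1 / qPoch q q k.toNat

theorem qRecip_natCast (q : ℂ) (n : ℕ) : qRecip q n = 1 / qPoch q q n := by
  simp [qRecip]

theorem qRecip_of_neg (q : ℂ) {k : ℤ} (hk : k < 0) : qRecip q k = 0 := by
  simp [qRecip, hk]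

theorem qRecip_zero (q : ℂ) : qRecip q 0 = 1 := by simp [qRecip]

/-- Extension by zero is consistent because 1 - q^0 = 0; bilateral sums then need no boundary terms.
-/
theorem qRecip_sub_one {q : ℂ} (hq : ‖q‖ < 1) (k : ℤ) :
    qRecip q (k - 1) = (1 - q ^ k) * qRecip q k := by
  rcases lt_trichotomy k 0 with hk | rfl | hk
  · rw [qRecip_of_neg q hk, qRecip_of_neg q (by omega), mul_zero]
  · simp [qRecip]
  · obtain ⟨n, rfl⟩ : ∃ n : ℕ, k = ((n + 1 : ℕ) : ℤ) := ⟨k.toNat - 1, by omega⟩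
    rw [show ((n + 1 : ℕ) : ℤ) - 1 = (n : ℤ) by push_cast; ring, qRecip_natCast, qRecip_natCast,
      qPoch_succ, zpow_natCast]
    have h1 := qPoch_ne_zero hq hq n
    have h2 := one_sub_mul_pow_ne_zero hq hq n
    rw [pow_succ' q n]
    field_simp

theorem tendsto_qRecip {q : ℂ} (hq : ‖q‖ < 1) (c : ℤ) :
    Tendsto (fun n : ℕ => qRecip q (n + c)) atTop (𝓝 (1 / qPochInf q q)) := by
  have h1 : Tendsto (fun n : ℕ => 1 / qPoch q q n) atTop (𝓝 (1 / qPochInf q q)) :=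
    tendsto_const_nhds.div (tendsto_qPoch q hq) (qPochInf_ne_zero hq hq)
  have h2 : Tendsto (fun n : ℕ => ((n : ℤ) + c).toNat) atTop atTop := by
    refine tendsto_atTop.mpr fun b => ?_
    filter_upwards [eventually_ge_atTop (b + c.natAbs)] with n hn
    omega
  refine (h1.comp h2).congr' ?_
  filter_upwards [eventually_ge_atTop c.natAbs] with n hn
  have : ¬ ((n : ℤ) + c < 0) := by omega
  simp [qRecip, this]

theorem exists_norm_qRecip_le {q : ℂ} (hq : ‖q‖ < 1) :
    ∃ C, 0 ≤ C ∧ ∀ k, ‖qRecip q k‖ ≤ C := by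
  obtain ⟨C, hC⟩ := (Metric.isBounded_range_of_tendsto _ (tendsto_qRecip hq 0)).exists_norm_le
  have h0 : ∀ n : ℕ, ‖qRecip q n‖ ≤ C := fun n => hC _ ⟨n, by simp⟩
  have hC0 : 0 ≤ C := (norm_nonneg _).trans (h0 0)
  refine ⟨C, hC0, fun k => ?_⟩
  rcases lt_or_ge k 0 with hk | hk
  · simpa [qRecip_of_neg q hk] using hC0
  · lift k to ℕ using hk
    exact h0 k

/-- The `q`-Pascal rule, written for reciprocals of `q`-factorials. -/
theorem qRecip_pascal {q : ℂ} (hq0 : q ≠ 0) (hq : ‖q‖ < 1) (k l : ℤ) :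
    (1 - q ^ (k + l)) * (qRecip q k * qRecip q l) =
      qRecip q (k - 1) * qRecip q l + q ^ k * (qRecip q k * qRecip q (l - 1)) := by
  rw [qRecip_sub_one hq, qRecip_sub_one hq, zpow_add₀ hq0]
  ring

end Reciprocal

/-! ### Convergence of theta series -/

section Theta

theorem summable_nat_theta {x p : ℂ} (hx : x ≠ 0) (hp0 : p ≠ 0) (hp : ‖p‖ < 1) :
    Summable fun n : ℕ => x ^ n * p ^ (n ^ 2) := by
  refine summable_of_ratio_test_tendsto_lt_one (l := 0) one_pos
    (Eventually.of_forall fun n => by simp [hx, hp0]) ?_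
  have h : ∀ n : ℕ, ‖x ^ (n + 1) * p ^ ((n + 1) ^ 2)‖ / ‖x ^ n * p ^ (n ^ 2)‖ =
      ‖x‖ * ‖p‖ * (‖p‖ ^ 2) ^ n := by
    intro n
    have := norm_ne_zero_iff.mpr hx
    have := norm_ne_zero_iff.mpr hp0
    simp only [norm_mul, norm_pow]
    rw [div_eq_iff (by positivity)]
    ring
  simp_rw [h]
  have := (tendsto_pow_atTop_nhds_zero_of_lt_one (r := ‖p‖ ^ 2) (by positivity)
    (pow_lt_one₀ (norm_nonneg _) hp two_ne_zero)).const_mul (‖x‖ * ‖p‖)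
  simpa using this

theorem summable_theta {x p : ℂ} (hx : x ≠ 0) (hp0 : p ≠ 0) (hp : ‖p‖ < 1) :
    Summable fun r : ℤ => x ^ r * p ^ (r ^ 2) := by
  refine Summable.of_nat_of_neg ?_ ?_
  · exact_mod_cast summable_nat_theta hx hp0 hp
  · refine (summable_nat_theta (inv_ne_zero hx) hp0 hp).congr fun n => ?_
    rw [neg_sq, zpow_neg, zpow_natCast, inv_pow]
    norm_cast

theorem theta_weight_add_one {x p : ℂ} (hx : x ≠ 0) (hp0 : p ≠ 0) (r : ℤ) :
    x ^ (r + 1) * p ^ ((r + 1) ^ 2) = x * p * (p ^ 2) ^ r * (x ^ r * p ^ (r ^ 2)) := by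
  rw [show (r + 1) ^ 2 = r ^ 2 + 2 * r + 1 by ring, zpow_add₀ hp0, zpow_add₀ hp0, zpow_add₀ hx,
    zpow_mul]
  norm_cast
  simp
  ring

/-- Theta weights against a product of two reciprocals of `q`-factorials are summable. -/
theorem summable_theta_mul_qRecip {x p q : ℂ} (hx : x ≠ 0) (hp0 : p ≠ 0) (hp : ‖p‖ < 1)
    (hq : ‖q‖ < 1) (k l : ℤ → ℤ) :
    Summable fun r : ℤ => x ^ r * p ^ (r ^ 2) * (qRecip q (k r) * qRecip q (l r)) := by
  obtain ⟨C, hC0, hC⟩ := exists_norm_qRecip_le hq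
  refine Summable.of_norm_bounded ((summable_theta hx hp0 hp).norm.mul_right (C * C)) fun r => ?_
  rw [norm_mul, norm_mul (qRecip q _)]
  gcongr <;> apply hC

end Theta

/-! ### Jacobi triple product -/

section JacobiTripleProduct

/-- A finite form of the theta series, over `(p²; p²)_{c+d}`. -/
noncomputable def finiteTheta (x p : ℂ) (c d : ℤ) : ℂ :=
  ∑' r : ℤ, (-x) ^ r * p ^ (r ^ 2) * (qRecip (p ^ 2) (c + r) * qRecip (p ^ 2) (d - r))

variable {x p : ℂ}

theorem norm_sq_lt_one (hp : ‖p‖ < 1) : ‖p ^ 2‖ < 1 := by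
  rw [norm_pow]; exact pow_lt_one₀ (norm_nonneg _) hp two_ne_zero

theorem finiteTheta_symm (c d : ℤ) : finiteTheta x p c d = finiteTheta x⁻¹ p d c := by
  rw [finiteTheta, finiteTheta, ← (Equiv.neg ℤ).tsum_eq]
  refine tsum_congr fun r => ?_
  rw [Equiv.neg_apply, neg_sq, zpow_neg, ← inv_zpow, inv_neg, sub_neg_eq_add, ← sub_eq_add_neg,
    mul_comm (qRecip _ (c - r))]

/-- The q-Pascal rule splits each term in two. In the second part the factor (p²)^{c+r} is what the
theta weight gains under r ↦ r + 1, so both parts are multiples of the same sum. -/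
theorem finiteTheta_left (hx : x ≠ 0) (hp0 : p ≠ 0) (hp : ‖p‖ < 1) (c d : ℤ) :
    (1 - (p ^ 2) ^ (c + d)) * finiteTheta x p c d =
      (1 - (p ^ 2) ^ c / (x * p)) * finiteTheta x p (c - 1) d := by
  have hs := fun k l => summable_theta_mul_qRecip (neg_ne_zero.mpr hx) hp0 hp
    (norm_sq_lt_one hp) k l
  have h2 : ∑' r : ℤ, (-x) ^ r * p ^ (r ^ 2) * ((p ^ 2) ^ (c + r) *
      (qRecip (p ^ 2) (c + r) * qRecip (p ^ 2) (d - r - 1))) =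
      -((p ^ 2) ^ c / (x * p)) * finiteTheta x p (c - 1) d := by
    rw [finiteTheta, ← tsum_mul_left, ← (Equiv.addRight (1 : ℤ)).tsum_eq
      (fun r : ℤ => -((p ^ 2) ^ c / (x * p)) * ((-x) ^ r * p ^ (r ^ 2) * _))]
    refine tsum_congr fun r => ?_
    rw [Equiv.coe_addRight, theta_weight_add_one (neg_ne_zero.mpr hx) hp0,
      show c - 1 + (r + 1) = c + r by ring, show d - (r + 1) = d - r - 1 by ring,
      zpow_add₀ (pow_ne_zero 2 hp0)]
    field_simp
  -- The power (p²)^{c+r} is unbounded in r, so summability is read off from q-Pascal as a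
  -- difference of summable series.
  have h2s : Summable fun r : ℤ => (-x) ^ r * p ^ (r ^ 2) * ((p ^ 2) ^ (c + r) *
      (qRecip (p ^ 2) (c + r) * qRecip (p ^ 2) (d - r - 1))) := by
    have := ((hs (fun r => c + r) (fun r => d - r)).mul_left (1 - (p ^ 2) ^ (c + d))).sub
      (hs (fun r => c + r - 1) (fun r => d - r))
    refine this.congr fun r => ?_
    have := qRecip_pascal (pow_ne_zero 2 hp0) (norm_sq_lt_one hp) (c + r) (d - r)
    rw [show c + r + (d - r) = c + d by ring] at this
    linear_combination ((-x) ^ r * p ^ (r ^ 2)) * this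
  have h1 : finiteTheta x p (c - 1) d = ∑' r : ℤ, (-x) ^ r * p ^ (r ^ 2) *
      (qRecip (p ^ 2) (c + r - 1) * qRecip (p ^ 2) (d - r)) := by
    simp only [finiteTheta, sub_add_eq_add_sub]
  rw [sub_mul _ _ (finiteTheta x p (c - 1) d), one_mul, sub_eq_add_neg (finiteTheta x p (c - 1) d),
    ← neg_mul, ← h2, h1, ← (hs _ _).tsum_add h2s, finiteTheta, ← tsum_mul_left]
  refine tsum_congr fun r => ?_
  have := qRecip_pascal (pow_ne_zero 2 hp0) (norm_sq_lt_one hp) (c + r) (d - r)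
  rw [show c + r + (d - r) = c + d by ring] at this
  linear_combination ((-x) ^ r * p ^ (r ^ 2)) * this

theorem finiteTheta_right (hx : x ≠ 0) (hp0 : p ≠ 0) (hp : ‖p‖ < 1) (c d : ℤ) :
    (1 - (p ^ 2) ^ (c + d)) * finiteTheta x p c d =
      (1 - (p ^ 2) ^ d * x / p) * finiteTheta x p c (d - 1) := by
  rw [finiteTheta_symm c d, finiteTheta_symm c (d - 1), add_comm,
    finiteTheta_left (inv_ne_zero hx) hp0 hp]
  congr 2
  field_simp

theorem finiteTheta_zero (x p : ℂ) : finiteTheta x p 0 0 = 1 := by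
  rw [finiteTheta, tsum_eq_single 0]
  · simp [qRecip_zero]
  · intro r hr
    rcases lt_or_gt_of_ne hr with h | h
    · rw [qRecip_of_neg (p ^ 2) (k := 0 + r) (by omega)]; simp
    · rw [qRecip_of_neg (p ^ 2) (k := 0 - r) (by omega)]; simp

/-- Finite form of the Jacobi triple product identity. -/
theorem qPoch_mul_finiteTheta (hx : x ≠ 0) (hp0 : p ≠ 0) (hp : ‖p‖ < 1) (n : ℕ) :
    qPoch (p ^ 2) (p ^ 2) (2 * n) * finiteTheta x p n n =
      qPoch (x * p) (p ^ 2) n * qPoch (p / x) (p ^ 2) n := by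
  induction n with
  | zero => simp [finiteTheta_zero]
  | succ n ih =>
    -- Lower the first index, then the second; each step contributes one factor of one product.
    have h1 := finiteTheta_left hx hp0 hp (n + 1) (n + 1)
    have h2 := finiteTheta_right hx hp0 hp n (n + 1)
    rw [add_sub_cancel_right] at h1 h2
    have e1 : (p ^ 2) ^ ((n : ℤ) + 1 + (n + 1)) = p ^ 2 * (p ^ 2) ^ (2 * n + 1) := by
      rw [show (n : ℤ) + 1 + (n + 1) = ((2 * n + 1 + 1 : ℕ) : ℤ) by push_cast; ring,
        zpow_natCast, pow_succ']
    have e2 : (p ^ 2) ^ ((n : ℤ) + (n + 1)) = p ^ 2 * (p ^ 2) ^ (2 * n) := by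
      rw [show (n : ℤ) + (n + 1) = ((2 * n + 1 : ℕ) : ℤ) by push_cast; ring,
        zpow_natCast, pow_succ']
    have e3 : (p ^ 2) ^ ((n : ℤ) + 1) = p ^ 2 * (p ^ 2) ^ n := by
      rw [← pow_succ']; norm_cast
    rw [e1, e3] at h1
    rw [e2, e3] at h2
    rw [show 2 * (n + 1) = 2 * n + 1 + 1 by ring, qPoch_succ, qPoch_succ, qPoch_succ, qPoch_succ]
    push_cast
    have a1 : p ^ 2 * (p ^ 2) ^ n / (x * p) = p / x * (p ^ 2) ^ n := by field_simp
    have a2 : p ^ 2 * (p ^ 2) ^ n * x / p = x * p * (p ^ 2) ^ n := by field_simp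
    rw [a1] at h1
    rw [a2] at h2
    linear_combination qPoch (p ^ 2) (p ^ 2) (2 * n) * (1 - p ^ 2 * (p ^ 2) ^ (2 * n)) * h1 +
      qPoch (p ^ 2) (p ^ 2) (2 * n) * (1 - p / x * (p ^ 2) ^ n) * h2 +
      (1 - p / x * (p ^ 2) ^ n) * (1 - x * p * (p ^ 2) ^ n) * ih

/-- The Jacobi triple product identity. -/
theorem tsum_theta (hx : x ≠ 0) (hp0 : p ≠ 0) (hp : ‖p‖ < 1) :
    ∑' r : ℤ, (-x) ^ r * p ^ (r ^ 2) =
      qPochInf (p ^ 2) (p ^ 2) * qPochInf (x * p) (p ^ 2) * qPochInf (p / x) (p ^ 2) := by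
  have hp2 := norm_sq_lt_one hp
  have hne := qPochInf_ne_zero hp2 hp2
  obtain ⟨C, hC0, hC⟩ := exists_norm_qRecip_le hp2
  have hs := summable_theta (neg_ne_zero.mpr hx) hp0 hp
  have h1 : Tendsto (fun n : ℕ => finiteTheta x p n n) atTop
      (𝓝 (∑' r : ℤ, (-x) ^ r * p ^ (r ^ 2) *
        (1 / qPochInf (p ^ 2) (p ^ 2) * (1 / qPochInf (p ^ 2) (p ^ 2))))) := by
    refine tendsto_tsum_of_dominated_convergence (hs.norm.mul_right (C * C))
      (fun r => ((tendsto_qRecip hp2 r).mul ?_).const_mul _)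
      (Eventually.of_forall fun n r => ?_)
    · simpa [sub_eq_add_neg] using tendsto_qRecip hp2 (-r)
    · rw [norm_mul, norm_mul (qRecip _ _)]
      gcongr <;> apply hC
  have h2 : Tendsto (fun n : ℕ => qPoch (p ^ 2) (p ^ 2) (2 * n)) atTop
      (𝓝 (qPochInf (p ^ 2) (p ^ 2))) :=
    (tendsto_qPoch _ hp2).comp (tendsto_id.const_mul_atTop' two_pos)
  have h3 := h2.mul h1
  simp_rw [qPoch_mul_finiteTheta hx hp0 hp] at h3
  have h4 := tendsto_nhds_unique h3 ((tendsto_qPoch (x * p) hp2).mul (tendsto_qPoch (p / x) hp2))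
  rw [tsum_mul_right] at h4
  rw [mul_assoc, ← h4]
  field_simp

end JacobiTripleProduct

/-! ### The Bailey pair -/

section BaileyPair

variable {q : ℂ}

/-- The alternating sum `∑ (-1)^r q^{r²+r} / ((q;q)_{c-2r} (q;q)_{d+2r})`. -/
noncomputable def baileySum (q : ℂ) (c d : ℤ) : ℂ :=
  ∑' r : ℤ, (-q) ^ r * q ^ (r ^ 2) * (qRecip q (c - 2 * r) * qRecip q (d + 2 * r))

/-- The involution r ↦ -1 - r fixes r² + r and flips the sign (-1)^r. -/
theorem baileySum_reflect (hq0 : q ≠ 0) (c d : ℤ) :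
    baileySum q c d = -baileySum q (d - 2) (c + 2) := by
  rw [baileySum, baileySum, ← tsum_neg, ← (Equiv.subLeft (-1 : ℤ)).tsum_eq]
  refine tsum_congr fun r => ?_
  have h : (-q) ^ (-1 - r) * q ^ ((-1 - r) ^ 2) = -((-q) ^ r * q ^ (r ^ 2)) := by
    have hn : ((-1 : ℂ) ^ r) * (-1) ^ r = 1 := by rw [← mul_zpow]; simp
    have hn0 : (-1 : ℂ) ^ r ≠ 0 := zpow_ne_zero _ (by norm_num)
    rw [← neg_one_mul q, mul_zpow, mul_zpow, zpow_sub₀ (by norm_num : (-1 : ℂ) ≠ 0),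
      mul_assoc, mul_assoc, ← zpow_add₀ hq0, ← zpow_add₀ hq0,
      show -1 - r + (-1 - r) ^ 2 = r + r ^ 2 by ring, div_mul_eq_mul_div, div_eq_iff hn0, zpow_neg_one]
    linear_combination q ^ (r + r ^ 2) * hn
  rw [Equiv.subLeft_apply, h, show c - 2 * (-1 - r) = c + 2 + 2 * r by ring,
    show d + 2 * (-1 - r) = d - 2 - 2 * r by ring]
  ring

theorem baileySum_pascal (hq0 : q ≠ 0) (hq : ‖q‖ < 1) (c d : ℤ) :
    (1 - q ^ (c + d)) * baileySum q c d =
      baileySum q (c - 1) d - q ^ c * baileySum q (c - 2) (d + 1) := by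
  have hs := fun k l => summable_theta_mul_qRecip (neg_ne_zero.mpr hq0) hq0 hq hq k l
  have hpow : ∀ r : ℤ, q ^ (c - 2 * r) = q ^ c * q ^ (-(2 * r)) := fun r => by
    rw [sub_eq_add_neg, zpow_add₀ hq0]
  have h2 : baileySum q (c - 2) (d + 1) = -∑' r : ℤ, (-q) ^ r * q ^ (r ^ 2) * q ^ (-(2 * r)) *
      (qRecip q (c - 2 * r) * qRecip q (d + 2 * r - 1)) := by
    rw [baileySum, ← (Equiv.addRight (1 : ℤ)).tsum_eq
      (fun r : ℤ => (-q) ^ r * q ^ (r ^ 2) * q ^ (-(2 * r)) * _),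
      ← tsum_neg]
    refine tsum_congr fun r => ?_
    rw [Equiv.coe_addRight, theta_weight_add_one (neg_ne_zero.mpr hq0) hq0,
      show c - 2 * (r + 1) = c - 2 - 2 * r by ring,
      show d + 2 * (r + 1) - 1 = d + 1 + 2 * r by ring, show -(2 * (r + 1)) = -(2 * r) - 2 by ring,
      zpow_sub₀ hq0, zpow_neg, zpow_mul]
    have : (q ^ 2) ^ r ≠ 0 := zpow_ne_zero _ (pow_ne_zero 2 hq0)
    norm_cast
    field_simp
  have h2s : Summable fun r : ℤ => (-q) ^ r * q ^ (r ^ 2) * q ^ (-(2 * r)) *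
      (qRecip q (c - 2 * r) * qRecip q (d + 2 * r - 1)) := by
    have := ((hs (fun r => c - 2 * r) (fun r => d + 2 * r)).mul_left
      (q ^ (-c) * (1 - q ^ (c + d)))).sub
      ((hs (fun r => c - 2 * r - 1) (fun r => d + 2 * r)).mul_left (q ^ (-c)))
    refine this.congr fun r => ?_
    have := qRecip_pascal hq0 hq (c - 2 * r) (d + 2 * r)
    rw [show c - 2 * r + (d + 2 * r) = c + d by ring, hpow] at this
    have hc : q ^ (-c) * q ^ c = 1 := by rw [← zpow_add₀ hq0]; simp
    linear_combination ((-q) ^ r * q ^ (r ^ 2)) * q ^ (-c) * this +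
      (-q) ^ r * q ^ (r ^ 2) * q ^ (-(2 * r)) * qRecip q (c - 2 * r) * qRecip q (d + 2 * r - 1) * hc
  have h1 : baileySum q (c - 1) d = ∑' r : ℤ, (-q) ^ r * q ^ (r ^ 2) *
      (qRecip q (c - 2 * r - 1) * qRecip q (d + 2 * r)) := by
    simp only [baileySum, sub_right_comm]
  rw [h1, h2, mul_neg, sub_neg_eq_add, ← tsum_mul_left, ← (hs _ _).tsum_add (h2s.mul_left _),
    baileySum, ← tsum_mul_left]
  refine tsum_congr fun r => ?_
  have := qRecip_pascal hq0 hq (c - 2 * r) (d + 2 * r)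
  rw [show c - 2 * r + (d + 2 * r) = c + d by ring, hpow] at this
  linear_combination ((-q) ^ r * q ^ (r ^ 2)) * this

theorem baileySum_zero_one (q : ℂ) : baileySum q 0 1 = 1 / (1 - q) := by
  rw [baileySum, tsum_eq_single 0]
  · have : qRecip q 1 = 1 / (1 - q) := by
      simpa [qPoch] using qRecip_natCast q 1
    simp [qRecip_zero, this]
  · intro r hr
    rcases lt_or_gt_of_ne hr with h | h
    · rw [qRecip_of_neg q (k := 1 + 2 * r) (by omega)]; simp
    · rw [qRecip_of_neg q (k := 0 - 2 * r) (by omega)]; simp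

/-- Write B for `baileySum q`. Pascal at (n+1, n+2) and (n+1, n+1), with reflection, gives (1 -
q^{2n+3}) B(n+1, n+2) = q^{n+1} B(n+1, n+1) and (1 - q^{2n+2}) B(n+1, n+1) = (1 + q^{n+1}) B(n,
n+1). The factor 1 + q^{n+1} cancels. -/
theorem baileySum_succ (hq0 : q ≠ 0) (hq : ‖q‖ < 1) (n : ℕ) :
    (1 - q * (q ^ 2) ^ (n + 1)) * (1 - q * q ^ n) * baileySum q (n + 1 : ℕ) ((n + 1 : ℕ) + 1) =
      q ^ (n + 1) * baileySum q n (n + 1) := by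
  push_cast
  have h1 := baileySum_pascal hq0 hq (n + 1) (n + 1 + 1)
  have h2 := baileySum_pascal hq0 hq (n + 1) (n + 1)
  have r1 := baileySum_reflect hq0 (n + 1 - 1) (n + 1 + 1)
  have r2 := baileySum_reflect hq0 (n + 1 - 2) (n + 1 + 1 + 1)
  have r3 := baileySum_reflect hq0 (n + 1 - 2) (n + 1 + 1)
  have s1 : (n : ℤ) + 1 + 1 - 2 = n := by ring
  have s2 : (n : ℤ) + 1 - 1 = n := by ring
  have s3 : (n : ℤ) + 1 + 1 + 1 - 2 = n + 1 := by ring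
  have s4 : (n : ℤ) + 1 - 2 + 2 = n + 1 := by ring
  have s5 : (n : ℤ) + 2 = n + 1 + 1 := by ring
  rw [s2, s1, s5] at r1
  rw [s3, s4] at r2
  rw [s1, s4] at r3
  rw [s2, r2] at h1
  rw [s2, r3] at h2
  have e1 : q ^ ((n : ℤ) + 1 + (n + 1 + 1)) = q * (q ^ 2) ^ (n + 1) := by
    rw [← pow_mul, ← pow_succ', ← zpow_natCast]; congr 1; push_cast; ring
  have e2 : q ^ ((n : ℤ) + 1 + (n + 1)) = (q * q ^ n) ^ 2 := by
    rw [← pow_succ', ← pow_mul, ← zpow_natCast]; congr 1; push_cast; ring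
  have e3 : q ^ ((n : ℤ) + 1) = q * q ^ n := by
    rw [← pow_succ']; norm_cast
  rw [e1, e3] at h1
  rw [e2, e3] at h2
  have hne : 1 + q * q ^ n ≠ 0 := by
    have := one_sub_mul_pow_ne_zero (a := -q) (by simpa using hq) hq n
    simpa using this
  apply mul_left_cancel₀ hne
  rw [pow_succ']
  -- The index pair (n, n+2) is its own reflection.
  have r1' : baileySum q n (n + 1 + 1) = 0 := by linear_combination r1 / 2
  rw [r1'] at h1
  linear_combination (1 - (q * q ^ n) ^ 2) * h1 + q * q ^ n * h2

theorem baileySum_eq (hq0 : q ≠ 0) (hq : ‖q‖ < 1) (n : ℕ) :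
    baileySum q n (n + 1) =
      q ^ ((n ^ 2 + n) / 2) / (qPoch q (q ^ 2) (n + 1) * qPoch q q n) := by
  have hq2 := norm_sq_lt_one hq
  induction n with
  | zero => simpa [qPoch] using baileySum_zero_one q
  | succ n ih =>
    have h := baileySum_succ hq0 hq n
    have h1 := one_sub_mul_pow_ne_zero hq hq2 (n + 1)
    have h2 := one_sub_mul_pow_ne_zero hq hq n
    have h3 := qPoch_ne_zero hq hq2 (n + 1)
    have h4 := qPoch_ne_zero hq hq n
    rw [ih] at h
    rw [show ((n + 1) ^ 2 + (n + 1)) / 2 = (n ^ 2 + n) / 2 + (n + 1) by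
      rw [show (n + 1) ^ 2 + (n + 1) = n ^ 2 + n + (n + 1) * 2 by ring]; omega,
      pow_add, qPoch_succ q (q ^ 2) (n + 1), qPoch_succ q q n]
    have : baileySum q (n + 1 : ℕ) ((n + 1 : ℕ) + 1) = q ^ (n + 1) * (q ^ ((n ^ 2 + n) / 2) /
      (qPoch q (q ^ 2) (n + 1) * qPoch q q n)) /
        ((1 - q * (q ^ 2) ^ (n + 1)) * (1 - q * q ^ n)) := by
      rw [eq_div_iff (mul_ne_zero h1 h2), ← h]; ring
    rw [this]
    field_simp

end BaileyPair

/-! ### Durfee rectangles and the Bailey kernel -/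

section DurfeeRectangle

variable {q : ℂ}

/-- The generating function of partitions by Durfee rectangles of shape `m × (m + N)`. -/
noncomputable def durfeeSum (q : ℂ) (N : ℕ) : ℂ :=
  ∑' m : ℕ, q ^ (m ^ 2 + m * N) * (qRecip q m * qRecip q (m + N : ℕ))

theorem exists_norm_durfee_term_le (hq : ‖q‖ < 1) :
    ∃ C : ℝ, ∀ N m : ℕ, ‖q ^ (m ^ 2 + m * N) * (qRecip q m * qRecip q (m + N : ℕ))‖ ≤
      ‖q‖ ^ m * C := by
  obtain ⟨C, hC0, hC⟩ := exists_norm_qRecip_le hq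
  refine ⟨C * C, fun N m => ?_⟩
  rw [norm_mul, norm_mul (qRecip _ _), norm_pow]
  have h1 : ‖q‖ ^ (m ^ 2 + m * N) ≤ ‖q‖ ^ m :=
    pow_le_pow_of_le_one (norm_nonneg _) hq.le
      ((Nat.le_self_pow two_ne_zero m).trans (Nat.le_add_right _ _))
  gcongr <;> apply hC

theorem summable_durfee (hq : ‖q‖ < 1) (N : ℕ) :
    Summable fun m : ℕ => q ^ (m ^ 2 + m * N) * (qRecip q m * qRecip q (m + N : ℕ)) := by
  obtain ⟨C, hC⟩ := exists_norm_durfee_term_le hq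
  exact Summable.of_norm_bounded
    ((summable_geometric_of_lt_one (norm_nonneg q) hq).mul_right C) (hC N)

theorem qRecip_natCast_eq (hq : ‖q‖ < 1) (n : ℕ) :
    qRecip q n = (1 - q ^ (n + 1)) * qRecip q (n + 1 : ℕ) := by
  have := qRecip_sub_one hq (n + 1 : ℕ)
  rw [zpow_natCast] at this
  rw [← this]
  simp

/-- In D_N - (1 - q^{N+1}) D_{N+1} the m = 0 term vanishes, and the term m + 1 is q^{N+1} times the
term m of D_{N+2}. -/
theorem durfeeSum_sub (hq : ‖q‖ < 1) (N : ℕ) :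
    durfeeSum q N - durfeeSum q (N + 1) =
      -q ^ (N + 1) * (durfeeSum q (N + 1) - durfeeSum q (N + 2)) := by
  have s0 := summable_durfee hq N
  have s1 := summable_durfee hq (N + 1)
  have s := (s0.sub s1).add (s1.mul_left (q ^ (N + 1)))
  have h : durfeeSum q N - durfeeSum q (N + 1) + q ^ (N + 1) * durfeeSum q (N + 1) =
      q ^ (N + 1) * durfeeSum q (N + 2) := by
    simp only [durfeeSum]
    rw [← s0.tsum_sub s1, ← tsum_mul_left, ← (s0.sub s1).tsum_add (s1.mul_left _),
      s.tsum_eq_zero_add, ← tsum_mul_left]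
    have h0 := qRecip_natCast_eq hq N
    have hzero : q ^ (0 ^ 2 + 0 * N) * (qRecip q (0 : ℕ) * qRecip q (0 + N : ℕ)) -
        q ^ (0 ^ 2 + 0 * (N + 1)) * (qRecip q (0 : ℕ) * qRecip q (0 + (N + 1) : ℕ)) +
        q ^ (N + 1) * (q ^ (0 ^ 2 + 0 * (N + 1)) *
          (qRecip q (0 : ℕ) * qRecip q (0 + (N + 1) : ℕ))) = 0 := by
      rw [zero_add N, zero_add (N + 1), h0]
      ring
    refine (congrArg₂ (· + ·) hzero (tsum_congr fun m => ?_)).trans (zero_add _)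
    have h1 := qRecip_natCast_eq hq m
    have h2 := qRecip_natCast_eq hq (m + 1 + N)
    rw [show m + (N + 2) = m + 1 + N + 1 by ring, show m + 1 + (N + 1) = m + 1 + N + 1 by ring,
      h1, h2]
    ring
  linear_combination h

theorem tendsto_durfeeSum (hq : ‖q‖ < 1) :
    Tendsto (durfeeSum q) atTop (𝓝 (1 / qPochInf q q)) := by
  obtain ⟨C, hC⟩ := exists_norm_durfee_term_le hq
  have h : Tendsto (durfeeSum q) atTop (𝓝 (∑' m : ℕ, (if m = 0 then (1 : ℂ) else 0) *
      (qRecip q m * (1 / qPochInf q q)))) := by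
    refine tendsto_tsum_of_dominated_convergence
      ((summable_geometric_of_lt_one (norm_nonneg q) hq).mul_right C)
      (fun m => Tendsto.mul ?_ (Tendsto.const_mul _ ?_)) (Eventually.of_forall hC)
    · rcases eq_or_ne m 0 with rfl | hm
      · simp
      · rw [if_neg hm]
        refine (tendsto_pow_atTop_nhds_zero_of_norm_lt_one hq).comp ?_
        exact tendsto_atTop_mono (fun N => (Nat.le_mul_of_pos_left N
          (Nat.pos_of_ne_zero hm)).trans (Nat.le_add_left _ _)) tendsto_id
    · refine (tendsto_qRecip hq m).congr fun N => ?_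
      rw [Nat.cast_add, add_comm]
  rw [tsum_eq_single 0 (fun m hm => by simp [hm])] at h
  simpa [qRecip_zero] using h

/-- By `durfeeSum_sub` the norms of consecutive differences do not decrease in N, yet they tend to
0. Hence all differences vanish and every value equals the limit. -/
theorem durfeeSum_eq (hq : ‖q‖ < 1) (N : ℕ) : durfeeSum q N = 1 / qPochInf q q := by
  have hlim := tendsto_durfeeSum hq
  have hE : Tendsto (fun N => durfeeSum q N - durfeeSum q (N + 1)) atTop (𝓝 0) := by
    simpa using hlim.sub (hlim.comp (tendsto_add_atTop_nat 1))
  have hstep : ∀ N, ‖durfeeSum q N - durfeeSum q (N + 1)‖ ≤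
      ‖durfeeSum q (N + 1) - durfeeSum q (N + 1 + 1)‖ := by
    intro N
    rw [durfeeSum_sub hq N, norm_mul, norm_neg, norm_pow]
    exact mul_le_of_le_one_left (norm_nonneg _) (pow_le_one₀ (norm_nonneg _) hq.le)
  have hmono : Monotone fun N => ‖durfeeSum q N - durfeeSum q (N + 1)‖ :=
    monotone_nat_of_le_succ hstep
  have hzero : ∀ N, durfeeSum q N = durfeeSum q (N + 1) := fun N => by
    have := hmono.ge_of_tendsto (by simpa using hE.norm) N
    exact sub_eq_zero.mp (norm_le_zero_iff.mp this)
  have hconst : ∀ M, durfeeSum q (M + N) = durfeeSum q N := fun M => by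
    induction M with
    | zero => simp
    | succ M ih => rw [← ih, hzero (M + N), Nat.add_right_comm]
  exact tendsto_nhds_unique (tendsto_const_nhds.congr fun M => (hconst M).symm)
    (hlim.comp (tendsto_add_atTop_nat N))

/-- With n = m + j, n² + n = (m² + m(2j+1)) + (j² + j): the Durfee sum with N = 2j + 1. -/
theorem hasSum_bailey_kernel_natCast (hq : ‖q‖ < 1) (j : ℕ) :
    HasSum (fun n : ℕ => q ^ (n ^ 2 + n) * (qRecip q (n - j) * qRecip q (n + 1 + j)))
      (q ^ (j ^ 2 + j) / qPochInf q q) := by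
  have h := (summable_durfee hq (2 * j + 1)).hasSum
  rw [← durfeeSum, durfeeSum_eq hq] at h
  have h2 := h.mul_left (q ^ (j ^ 2 + j))
  rw [mul_one_div] at h2
  rw [← (add_left_injective j).hasSum_iff]
  · refine h2.congr_fun fun m => ?_
    rw [Function.comp_apply]
    rw [show ((m + j : ℕ) : ℤ) - j = m by push_cast; ring,
      show ((m + j : ℕ) : ℤ) + 1 + j = (m + (2 * j + 1) : ℕ) by push_cast; ring]
    ring
  · intro n hn
    have : n < j := by
      by_contra hnj
      exact hn ⟨n - j, Nat.sub_add_cancel (not_lt.mp hnj)⟩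
    rw [qRecip_of_neg q (by omega)]
    simp

theorem hasSum_bailey_kernel (hq : ‖q‖ < 1) (j : ℤ) :
    HasSum (fun n : ℕ => q ^ (n ^ 2 + n) * (qRecip q (n - j) * qRecip q (n + 1 + j)))
      (q ^ (j ^ 2 + j) / qPochInf q q) := by
  rcases le_or_gt 0 j with hj | hj
  · lift j to ℕ using hj
    exact_mod_cast hasSum_bailey_kernel_natCast hq j
  · obtain ⟨k, rfl⟩ : ∃ k : ℕ, j = -1 - k := ⟨(-1 - j).toNat, by omega⟩
    have h := hasSum_bailey_kernel_natCast hq k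
    rw [show (-1 - (k : ℤ)) ^ 2 + (-1 - k) = ((k ^ 2 + k : ℕ) : ℤ) by push_cast; ring,
      zpow_natCast]
    refine h.congr_fun fun n => ?_
    rw [mul_comm (qRecip q _), show (n : ℤ) + 1 + (-1 - k) = n - k by ring,
      show (n : ℤ) - (-1 - k) = n + 1 + k by ring]

end DurfeeRectangle

/-! ### Assembling the identity -/

section Main

variable {q : ℂ}

theorem hasSum_baileySum (hq0 : q ≠ 0) (hq : ‖q‖ < 1) :
    HasSum (fun n : ℕ => q ^ (n ^ 2 + n) * baileySum q n (n + 1))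
      ((∑' r : ℤ, (-q ^ 3) ^ r * (q ^ 5) ^ (r ^ 2)) / qPochInf q q) := by
  obtain ⟨C, hC0, hC⟩ := exists_norm_qRecip_le hq
  have hθ := summable_theta (neg_ne_zero.mpr hq0) hq0 hq
  have hn : Summable fun n : ℕ => ‖q‖ ^ (n ^ 2 + n) := by
    refine Summable.of_nonneg_of_le (fun n => by positivity) (fun n => ?_)
      (summable_geometric_of_lt_one (norm_nonneg q) hq)
    exact pow_le_pow_of_le_one (norm_nonneg _) hq.le (Nat.le_add_left _ _)
  -- Boundedness of `qRecip` gives a product majorant, which justifies exchanging the two sums.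
  have hs : Summable (Function.uncurry fun (n : ℕ) (r : ℤ) => q ^ (n ^ 2 + n) *
      ((-q) ^ r * q ^ (r ^ 2) * (qRecip q (n - 2 * r) * qRecip q (n + 1 + 2 * r)))) := by
    refine Summable.of_norm_bounded ((hn.mul_of_nonneg hθ.norm (fun n => by positivity)
      (fun r => norm_nonneg _)).mul_right (C * C)) ?_
    rintro ⟨n, r⟩
    simp only [Function.uncurry_apply_pair]
    rw [norm_mul, norm_mul _ (qRecip _ _ * _), norm_mul (qRecip _ _), norm_pow, mul_assoc]
    gcongr <;> apply hC
  have h := hs.prod.hasSum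
  simp only [Function.uncurry_apply_pair] at h
  rw [← hs.tsum_comm] at h
  refine HasSum.congr_fun ?_ fun n => (tsum_mul_left (a := q ^ (n ^ 2 + n))).symm
  refine Eq.mp (congrArg (HasSum _) (Eq.symm ?_)) h
  rw [← tsum_div_const]
  refine tsum_congr fun r => ?_
  have hk := (hasSum_bailey_kernel hq (2 * r)).mul_left ((-q) ^ r * q ^ (r ^ 2))
  have e : (-q) ^ r * q ^ (r ^ 2) * q ^ ((2 * r) ^ 2 + 2 * r) =
      (-q ^ 3) ^ r * (q ^ 5) ^ (r ^ 2) := by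
    rw [← neg_one_mul q, ← neg_one_mul (q ^ 3), mul_zpow, mul_zpow, ← zpow_natCast q 3,
      ← zpow_natCast q 5, ← zpow_mul, ← zpow_mul, mul_assoc, mul_assoc, mul_assoc,
      ← zpow_add₀ hq0, ← zpow_add₀ hq0, ← zpow_add₀ hq0]
    congr 2
    push_cast
    ring
  rw [← mul_div_assoc, e] at hk
  rw [← hk.tsum_eq]
  exact tsum_congr fun n => by ring

theorem theta_div_eq (hq0 : q ≠ 0) (hq : ‖q‖ < 1) :
    (∑' r : ℤ, (-q ^ 3) ^ r * (q ^ 5) ^ (r ^ 2)) / qPochInf q q =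
      1 / (qPochInf q (q ^ 2) * qPochInf (q ^ 4) (q ^ 10) * qPochInf (q ^ 6) (q ^ 10)) := by
  have hpow : ∀ m : ℕ, m ≠ 0 → ‖q ^ m‖ < 1 := fun m hm => by
    rw [norm_pow]; exact pow_lt_one₀ (norm_nonneg _) hq hm
  rw [tsum_theta (pow_ne_zero 3 hq0) (pow_ne_zero 5 hq0) (hpow 5 (by norm_num)),
    qPochInf_eq_prod q hq two_ne_zero]
  -- Of the residues 2, 4, 6, 8, 10 modulo 10, the theta product cancels 2, 8 and 10.
  have h5 := qPochInf_eq_prod (q ^ 2) (hpow 2 two_ne_zero) (m := 5) (by norm_num)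
  simp only [Finset.prod_range_succ, Finset.prod_range_zero, one_mul, pow_zero, mul_one, pow_one,
    ← pow_mul, ← pow_add, ← pow_two] at h5 ⊢
  norm_num at h5 ⊢
  have hd : q ^ 5 / q ^ 3 = q ^ 2 := by field_simp
  rw [h5, hd]
  have h10 := hpow 10 (by norm_num)
  have a1 := qPochInf_ne_zero hq (hpow 2 (by norm_num))
  have a2 := qPochInf_ne_zero (hpow 2 (by norm_num)) h10
  have a4 := qPochInf_ne_zero (hpow 4 (by norm_num)) h10
  have a6 := qPochInf_ne_zero (hpow 6 (by norm_num)) h10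
  have a8 := qPochInf_ne_zero (hpow 8 (by norm_num)) h10
  have a10 := qPochInf_ne_zero (hpow 10 (by norm_num)) h10
  field_simp

theorem corollary2p8 (q : ℂ) (hq : ‖q‖ < 1) :
    -- the denominators of the series do not vanish
    (∀ n : ℕ, qPoch q (q ^ 2) (n + 1) * qPoch q q n ≠ 0) ∧
    -- the three infinite products converge, and their product does not vanish
    Multipliable (fun k : ℕ => 1 - q * (q ^ 2) ^ k) ∧
    Multipliable (fun k : ℕ => 1 - q ^ 4 * (q ^ 10) ^ k) ∧
    Multipliable (fun k : ℕ => 1 - q ^ 6 * (q ^ 10) ^ k) ∧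
    qPochInf q (q ^ 2) * qPochInf (q ^ 4) (q ^ 10) * qPochInf (q ^ 6) (q ^ 10) ≠ 0 ∧
    -- the series converges (unconditionally) to the stated value
    HasSum
      (fun n : ℕ => q ^ ((3 * n ^ 2 + 3 * n) / 2) / (qPoch q (q ^ 2) (n + 1) * qPoch q q n))
      (1 / (qPochInf q (q ^ 2) * qPochInf (q ^ 4) (q ^ 10) * qPochInf (q ^ 6) (q ^ 10))) := by
  have hpow : ∀ m : ℕ, m ≠ 0 → ‖q ^ m‖ < 1 := fun m hm => by
    rw [norm_pow]; exact pow_lt_one₀ (norm_nonneg _) hq hm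
  have h2 := hpow 2 (by norm_num)
  have h10 := hpow 10 (by norm_num)
  refine ⟨fun n => mul_ne_zero (qPoch_ne_zero hq h2 _) (qPoch_ne_zero hq hq _),
    multipliable_one_sub_mul_pow _ h2, multipliable_one_sub_mul_pow _ h10,
    multipliable_one_sub_mul_pow _ h10,
    mul_ne_zero (mul_ne_zero (qPochInf_ne_zero hq h2)
      (qPochInf_ne_zero (hpow 4 (by norm_num)) h10))
      (qPochInf_ne_zero (hpow 6 (by norm_num)) h10), ?_⟩
  -- Integer powers of q require q ≠ 0; at q = 0 only the n = 0 term survives.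
  rcases eq_or_ne q 0 with rfl | hq0
  · convert hasSum_single 0 fun n hn => ?_ using 1
    · simp [qPochInf, qPoch]
    · have : (3 * n ^ 2 + 3 * n) / 2 ≠ 0 := by
        have := Nat.pos_of_ne_zero hn
        have : 0 < n ^ 2 := by positivity
        omega
      simp [this]
  · have h := hasSum_baileySum hq0 hq
    rw [theta_div_eq hq0 hq] at h
    refine h.congr_fun fun n => ?_
    rw [baileySum_eq hq0 hq, ← mul_div_assoc, ← pow_add]
    congr 2
    -- Evenness of n² + n makes the truncated halves in the exponents exact.
    obtain ⟨k, hk⟩ := (Nat.even_mul_succ_self n).two_dvd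
    have : n ^ 2 + n = 2 * k := by rw [← hk]; ring
    omega

end Main
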